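/- Let $H$ and $K$ be complex Hilbert spaces and let $\mathbb D$ be the open unit disk. Write $L(H,K)$ for the bounded linear operators from $H$ to $K$, $H^2_H(\mathbb D)$ for the Hilbert space of analytic functions $f(z)=\sum_{n\ge 0} f_n z^n$ on $\mathbb D$ with $f_n\in H$ and $\|f\|^2=\sum_n\|f_n\|^2<\infty$, and $H^\infty_{L(H,K)}(\mathbb D)$ for the bounded holomorphic $L(H,K)$-valued functions on $\mathbb D$. For $G\in H^\infty_{L(H,K)}(\mathbb D)$ let $M_G: H^2_H(\mathbb D)\to H^2_K(\mathbb D)$, $(M_Gf)(z)=G(z)f(z)$, be the multiplication operator. The function $G$ is called \emph{outer} if there is a closed subspace $M$ of $K$ such that the range of $M_G$ is contained and dense in $H^2_M(\mathbb D)$, and \emph{inner} if $M_G$ is a partial isometry. Theorem (existence of inner-outer factorization). Let $A\in H^\infty_{L(H,K)}(\mathbb D)$. Then there exist an outer function $F\in H^\infty_{L(H,H)}(\mathbb D)$ and an inner function $V\in H^\infty_{L(H,K)}(\mathbb D)$ such that $A(z)=V(z)F(z)$ for all $z\in\mathbb D$. -/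

import Mathlib

open Filter Topology
open scoped Complex.UnitDisc

set_option linter.unusedSectionVars false

noncomputable section

namespace HardyFactorization

section Parseval

variable {E : Type*} [NormedAddCommGroup E] [InnerProductSpace ℂ E]

theorem integral_exp_sub (m n : ℕ) :
    (∫ t in (0 : ℝ)..2 * Real.pi,
      (starRingEnd ℂ) (Complex.exp (t * Complex.I) ^ m) * Complex.exp (t * Complex.I) ^ n) =
      if m = n then (2 * Real.pi : ℂ) else 0 := by
  have key : ∀ t : ℝ,
      (starRingEnd ℂ) (Complex.exp (t * Complex.I) ^ m) * Complex.exp (t * Complex.I) ^ n =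
        Complex.exp (((n : ℂ) - m) * Complex.I * t) := by
    intro t
    rw [map_pow, ← Complex.exp_conj, ← Complex.exp_nat_mul, ← Complex.exp_nat_mul,
      ← Complex.exp_add]
    congr 1
    simp
    ring
  simp_rw [key]
  split_ifs with h
  · subst h; simp
  · have hne : ((n : ℂ) - m) * Complex.I ≠ 0 := by
      refine mul_ne_zero (sub_ne_zero.2 ?_) Complex.I_ne_zero
      exact_mod_cast Ne.symm h
    rw [integral_exp_mul_complex hne]
    have h1 : Complex.exp (((n : ℂ) - m) * Complex.I * ((2 * Real.pi : ℝ) : ℂ)) = 1 := by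
      have := Complex.exp_int_mul_two_pi_mul_I ((n : ℤ) - m)
      rw [← this]
      congr 1
      push_cast
      ring
    rw [h1]
    simp

theorem parseval_sum (b : ℕ → E) (N : ℕ) :
    (∫ t in (0 : ℝ)..2 * Real.pi,
      ‖∑ n ∈ Finset.range N, Complex.exp (t * Complex.I) ^ n • b n‖ ^ 2) =
      2 * Real.pi * ∑ n ∈ Finset.range N, ‖b n‖ ^ 2 := by
  have key : ∀ t : ℝ,
      ((‖∑ n ∈ Finset.range N, Complex.exp (t * Complex.I) ^ n • b n‖ ^ 2 : ℝ) : ℂ) =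
        ∑ m ∈ Finset.range N, ∑ n ∈ Finset.range N,
          ((starRingEnd ℂ) (Complex.exp (t * Complex.I) ^ m) * Complex.exp (t * Complex.I) ^ n) *
            inner ℂ (b m) (b n) := by
    intro t
    have h := inner_self_eq_norm_sq_to_K (𝕜 := ℂ)
      (∑ n ∈ Finset.range N, Complex.exp (t * Complex.I) ^ n • b n)
    rw [Complex.ofReal_pow]
    refine h.symm.trans ?_
    rw [sum_inner]
    refine Finset.sum_congr rfl fun m _ => ?_
    rw [inner_sum]
    refine Finset.sum_congr rfl fun n _ => ?_
    rw [inner_smul_left, inner_smul_right]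
    ring
  have hC : ((∫ t in (0 : ℝ)..2 * Real.pi,
      ‖∑ n ∈ Finset.range N, Complex.exp (t * Complex.I) ^ n • b n‖ ^ 2 : ℝ) : ℂ) =
      ((2 * Real.pi * ∑ n ∈ Finset.range N, ‖b n‖ ^ 2 : ℝ) : ℂ) := by
    rw [← intervalIntegral.integral_ofReal]
    simp_rw [key]
    rw [intervalIntegral.integral_finsetSum]
    · rw [Finset.mul_sum]
      push_cast
      refine Finset.sum_congr rfl fun m hm => ?_
      rw [intervalIntegral.integral_finsetSum]
      · simp_rw [intervalIntegral.integral_mul_const, integral_exp_sub]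
        rw [Finset.sum_eq_single m]
        · rw [if_pos rfl, inner_self_eq_norm_sq_to_K]
          simp
        · intro n _ hn
          rw [if_neg hn.symm, zero_mul]
        · intro h
          exact absurd hm h
      · intro n _
        exact Continuous.intervalIntegrable (by fun_prop) _ _
    · intro m _
      exact Continuous.intervalIntegrable (by fun_prop) _ _
  exact_mod_cast hC

theorem parseval (b : ℕ → E) (hb : Summable fun n => ‖b n‖) (f : ℝ → E)
    (hf : ∀ t : ℝ, HasSum (fun n => Complex.exp (t * Complex.I) ^ n • b n) (f t)) :
    HasSum (fun n => ‖b n‖ ^ 2)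
      ((2 * Real.pi)⁻¹ * ∫ t in (0 : ℝ)..2 * Real.pi, ‖f t‖ ^ 2) := by
  have hpi : (0 : ℝ) < 2 * Real.pi := by positivity
  have hlim : Tendsto (fun N : ℕ => ∫ t in (0 : ℝ)..2 * Real.pi,
      ‖∑ n ∈ Finset.range N, Complex.exp (t * Complex.I) ^ n • b n‖ ^ 2) atTop
      (𝓝 (∫ t in (0 : ℝ)..2 * Real.pi, ‖f t‖ ^ 2)) := by
    refine intervalIntegral.tendsto_integral_filter_of_dominated_convergence
      (fun _ => (∑' n, ‖b n‖) ^ 2) ?_ ?_ ?_ ?_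
    · refine Eventually.of_forall fun N => ?_
      exact Continuous.aestronglyMeasurable (by fun_prop)
    · refine Eventually.of_forall fun N => Eventually.of_forall fun t _ => ?_
      rw [Real.norm_of_nonneg (by positivity)]
      gcongr
      refine (norm_sum_le _ _).trans ?_
      refine le_trans (Finset.sum_le_sum fun n _ => ?_)
        (hb.sum_le_tsum (Finset.range N) fun n _ => norm_nonneg _)
      rw [norm_smul, norm_pow, Complex.norm_exp_ofReal_mul_I, one_pow, one_mul]
    · simp
    · refine Eventually.of_forall fun t _ => ?_
      exact ((hf t).tendsto_sum_nat.norm).pow 2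
  rw [hasSum_iff_tendsto_nat_of_nonneg fun n => by positivity]
  have h2 := hlim.const_mul (2 * Real.pi)⁻¹
  refine h2.congr fun N => ?_
  rw [parseval_sum, ← mul_assoc, inv_mul_cancel₀ hpi.ne', one_mul]

theorem summable_norm_of_disk (a : ℕ → E) (f : 𝔻 → E)
    (hf : ∀ z : 𝔻, HasSum (fun n => (z : ℂ) ^ n • a n) (f z)) {r : ℝ} (h0 : 0 ≤ r) (h1 : r < 1) :
    Summable fun n => ‖((r : ℂ) ^ n • a n)‖ := by
  obtain ⟨s, hrs, hs1⟩ := exists_between h1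
  have hs0 : 0 < s := h0.trans_lt hrs
  have hs := (hf (Complex.UnitDisc.mk (s : ℂ) (by simpa [abs_of_pos hs0] using hs1))).summable
  have hten := hs.tendsto_atTop_zero.norm
  simp only [Complex.UnitDisc.coe_mk, norm_zero] at hten
  obtain ⟨C, hC⟩ := hten.bddAbove_range
  have hq : r / s < 1 := (div_lt_one hs0).2 hrs
  refine Summable.of_nonneg_of_le (fun _ => norm_nonneg _) (fun n => ?_)
    ((summable_geometric_of_lt_one (by positivity) hq).mul_left C)
  have hn : ‖((s : ℂ) ^ n • a n)‖ ≤ C := hC ⟨n, rfl⟩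
  rw [norm_smul, norm_pow, Complex.norm_real, Real.norm_of_nonneg hs0.le] at hn
  rw [norm_smul, norm_pow, Complex.norm_real, Real.norm_of_nonneg h0, div_pow]
  have : r ^ n * ‖a n‖ = (s ^ n * ‖a n‖) * (r ^ n / s ^ n) := by
    field_simp
  rw [this]
  gcongr

theorem norm_circle_lt {r : ℝ} (h0 : 0 ≤ r) (h1 : r < 1) (t : ℝ) :
    ‖(r : ℂ) * Complex.exp (t * Complex.I)‖ < 1 := by
  rw [norm_mul, Complex.norm_exp_ofReal_mul_I, mul_one, Complex.norm_real,
    Real.norm_of_nonneg h0]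
  exact h1

/-- The point `r e^{it}` of the disk. -/
def circlePt (r : ℝ) (h0 : 0 ≤ r) (h1 : r < 1) (t : ℝ) : 𝔻 :=
  Complex.UnitDisc.mk ((r : ℂ) * Complex.exp (t * Complex.I)) (norm_circle_lt h0 h1 t)

theorem parseval_disk (a : ℕ → E) (f : 𝔻 → E)
    (hf : ∀ z : 𝔻, HasSum (fun n => (z : ℂ) ^ n • a n) (f z)) {r : ℝ} (h0 : 0 ≤ r) (h1 : r < 1) :
    HasSum (fun n => (r ^ n * ‖a n‖) ^ 2)
      ((2 * Real.pi)⁻¹ * ∫ t in (0 : ℝ)..2 * Real.pi, ‖f (circlePt r h0 h1 t)‖ ^ 2) := by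
  have h := parseval (fun n => (r : ℂ) ^ n • a n) (summable_norm_of_disk a f hf h0 h1)
    (fun t => f (circlePt r h0 h1 t)) (fun t => by
      have := hf (circlePt r h0 h1 t)
      simp only [circlePt, Complex.UnitDisc.coe_mk, mul_pow] at this
      refine this.congr_fun fun n => ?_
      rw [smul_smul, mul_comm])
  refine h.congr_fun fun n => ?_
  rw [norm_smul, norm_pow, Complex.norm_real, Real.norm_of_nonneg h0]

theorem coeff_eq_zero (a : ℕ → E) (hf : ∀ z : 𝔻, HasSum (fun n => (z : ℂ) ^ n • a n) 0) (n : ℕ) :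
    a n = 0 := by
  have h := parseval_disk a (fun _ => 0) hf (r := 1 / 2) (by norm_num) (by norm_num)
  simp only [norm_zero, ne_eq, OfNat.ofNat_ne_zero, not_false_eq_true, zero_pow,
    intervalIntegral.integral_zero, mul_zero] at h
  have h2 := (hasSum_zero_iff_of_nonneg fun n => by positivity).1 h
  have h3 := congrFun h2 n
  simpa using h3

end Parseval

variable (H K : Type*) [NormedAddCommGroup H] [InnerProductSpace ℂ H] [CompleteSpace H]
  [NormedAddCommGroup K] [InnerProductSpace ℂ K] [CompleteSpace K]

/-- The functions `f : 𝔻 → H` of the form `f(z) = ∑ aₙ zⁿ` with `∑ ‖aₙ‖² < ∞`. -/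
def hardySubmodule : Submodule ℂ (𝔻 → H) where
  carrier := {f | ∃ a : lp (fun _ : ℕ => H) 2, ∀ z : 𝔻, HasSum (fun n => (z : ℂ) ^ n • a n) (f z)}
  add_mem' := by
    rintro f g ⟨a, ha⟩ ⟨b, hb⟩
    refine ⟨a + b, fun z => ?_⟩
    simpa [smul_add] using (ha z).add (hb z)
  zero_mem' := ⟨0, fun z => by simp⟩
  smul_mem' := by
    rintro c f ⟨a, ha⟩
    refine ⟨c • a, fun z => ?_⟩
    simpa [smul_comm c] using (ha z).const_smul c

/-- The Hardy space `H²_H(𝔻)` of `H`-valued analytic functions on the unit disk with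
square-summable Taylor coefficients. -/
def Hardy : Type _ := hardySubmodule H

instance : AddCommGroup (Hardy H) := inferInstanceAs (AddCommGroup (hardySubmodule H))

instance : Module ℂ (Hardy H) := inferInstanceAs (Module ℂ (hardySubmodule H))

instance : CoeFun (Hardy H) (fun _ => 𝔻 → H) := ⟨fun f => f.1⟩

variable {H K}

@[simp] theorem Hardy.add_apply (f g : Hardy H) (z : 𝔻) : (f + g) z = f z + g z := rfl

@[simp] theorem Hardy.smul_apply (c : ℂ) (f : Hardy H) (z : 𝔻) : (c • f) z = c • f z := rfl

@[ext] theorem Hardy.ext {f g : Hardy H} (h : ∀ z, f z = g z) : f = g :=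
  Subtype.ext (funext h)

theorem coeff_unique {f : 𝔻 → H} {a b : lp (fun _ : ℕ => H) 2}
    (ha : ∀ z : 𝔻, HasSum (fun n => (z : ℂ) ^ n • a n) (f z))
    (hb : ∀ z : 𝔻, HasSum (fun n => (z : ℂ) ^ n • b n) (f z)) : a = b := by
  refine lp.ext (funext fun n => sub_eq_zero.1 ?_)
  refine coeff_eq_zero (fun n => a n - b n) (fun z => ?_) n
  simpa [smul_sub] using (ha z).sub (hb z)

theorem summable_of_lp (a : lp (fun _ : ℕ => H) 2) (z : ℂ) (hz : ‖z‖ < 1) :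
    Summable (fun n => z ^ n • a n) := by
  refine Summable.of_norm_bounded
    ((summable_geometric_of_lt_one (norm_nonneg z) hz).mul_right ‖a‖) fun n => ?_
  rw [norm_smul, norm_pow]
  gcongr
  exact lp.norm_apply_le_norm (by norm_num) a n

/-- The sequence of Taylor coefficients of `f`. -/
def taylor (f : Hardy H) : lp (fun _ : ℕ => H) 2 := f.2.choose

theorem taylor_spec (f : Hardy H) (z : 𝔻) : HasSum (fun n => (z : ℂ) ^ n • taylor f n) (f z) :=
  f.2.choose_spec z

/-- The function `z ↦ ∑ aₙ zⁿ`. -/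
def ofLp (a : lp (fun _ : ℕ => H) 2) : Hardy H :=
  ⟨fun z => ∑' n, (z : ℂ) ^ n • a n, a, fun z => (summable_of_lp a z z.norm_lt_one).hasSum⟩

/-- The identification of `f(z) = ∑ aₙ zⁿ` with its sequence of Taylor coefficients. -/
def coeff : Hardy H ≃ₗ[ℂ] lp (fun _ : ℕ => H) 2 where
  toFun := taylor
  map_add' f g := coeff_unique (taylor_spec (f + g)) fun z => by
    simpa [smul_add] using (taylor_spec f z).add (taylor_spec g z)
  map_smul' c f := coeff_unique (taylor_spec (c • f)) fun z => by
    simpa [smul_comm c] using (taylor_spec f z).const_smul c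
  invFun := ofLp
  left_inv f := Hardy.ext fun z => (taylor_spec f z).tsum_eq
  right_inv a := coeff_unique (taylor_spec (ofLp a)) fun z =>
    (summable_of_lp a z z.norm_lt_one).hasSum

theorem hasSum_coeff (f : Hardy H) (z : 𝔻) : HasSum (fun n => (z : ℂ) ^ n • coeff f n) (f z) :=
  taylor_spec f z

/-- The norm of `f` is `(∑ ‖aₙ‖²)^{1/2}`. -/
instance : NormedAddCommGroup (Hardy H) :=
  NormedAddCommGroup.induced (Hardy H) (lp (fun _ : ℕ => H) 2) coeff coeff.injective

/-- The inner product of `∑ aₙ zⁿ` and `∑ bₙ zⁿ` is `∑ ⟪aₙ, bₙ⟫`. -/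
instance : InnerProductSpace ℂ (Hardy H) where
  norm_smul_le c f := by
    change ‖coeff (c • f)‖ ≤ ‖c‖ * ‖coeff f‖
    rw [map_smul, norm_smul]
  inner f g := inner ℂ (coeff f) (coeff g)
  norm_sq_eq_re_inner f := norm_sq_eq_re_inner (coeff f)
  conj_inner_symm f g := inner_conj_symm (coeff f) (coeff g)
  add_left f g h := by rw [map_add]; exact inner_add_left _ _ _
  smul_left f g c := by rw [map_smul]; exact inner_smul_left _ _ _

/-- The identification of the Hardy space with `ℓ²(ℕ, H)` is isometric. -/
def coeffIsometry : Hardy H ≃ₗᵢ[ℂ] lp (fun _ : ℕ => H) 2 where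
  toLinearEquiv := coeff
  norm_map' _ := rfl

instance : CompleteSpace (Hardy H) :=
  (completeSpace_congr (e := coeffIsometry.toEquiv)
    coeffIsometry.isometry.isUniformEmbedding).2 inferInstance

theorem hasSum_norm_sq (f : Hardy H) : HasSum (fun n => ‖coeff f n‖ ^ 2) (‖f‖ ^ 2) := by
  have h := lp.hasSum_norm (p := 2) (by norm_num) (coeff f)
  simp only [ENNReal.toReal_ofNat, Real.rpow_ofNat] at h
  exact h

/-- `F ∈ H^∞_{L(H,K)}(𝔻)`: bounded holomorphic on the unit disk. Values of `F` outside the open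
unit disk are irrelevant. -/
structure IsHInf (F : ℂ → H →L[ℂ] K) : Prop where
  differentiableOn : DifferentiableOn ℂ F (Metric.ball 0 1)
  bounded : ∃ C : ℝ, ∀ z ∈ Metric.ball (0 : ℂ) 1, ‖F z‖ ≤ C

theorem differentiableOn_extension (f : Hardy H) :
    DifferentiableOn ℂ (fun z : ℂ => ∑' n, z ^ n • coeff f n) (Metric.ball 0 1) := by
  intro w hw
  obtain ⟨r, hwr, hr1⟩ := exists_between (mem_ball_zero_iff.1 hw)
  have hr0 : 0 ≤ r := (norm_nonneg w).trans hwr.le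
  have hd : DifferentiableOn ℂ (fun z : ℂ => ∑' n, z ^ n • coeff f n) (Metric.ball 0 r) := by
    refine Complex.differentiableOn_tsum_of_summable_norm
      ((summable_geometric_of_lt_one hr0 hr1).mul_right ‖coeff f‖)
      (fun n => by fun_prop) Metric.isOpen_ball fun n z hz => ?_
    rw [norm_smul, norm_pow]
    have hz' : ‖z‖ ≤ r := (mem_ball_zero_iff.1 hz).le
    gcongr
    exact lp.norm_apply_le_norm (by norm_num) (coeff f) n
  exact (hd.differentiableAt
    (Metric.isOpen_ball.mem_nhds (mem_ball_zero_iff.2 hwr))).differentiableWithinAt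

theorem continuous_circle {f : 𝔻 → H} {g : ℂ → H} (hg : DifferentiableOn ℂ g (Metric.ball 0 1))
    (hfg : ∀ z : 𝔻, f z = g z) {r : ℝ} (h0 : 0 ≤ r) (h1 : r < 1) :
    Continuous fun t : ℝ => f (circlePt r h0 h1 t) := by
  simp_rw [hfg]
  refine hg.continuousOn.comp_continuous ?_ fun t => ?_
  · simp only [circlePt, Complex.UnitDisc.coe_mk]
    fun_prop
  · exact mem_ball_zero_iff.2 (circlePt r h0 h1 t).norm_lt_one

/-- If `F ∈ H^∞` is bounded by `C` and `f ∈ H²`, then `z ↦ F(z) f(z)` is in `H²`, with norm at most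
`C ‖f‖`. -/
theorem exists_mul {F : ℂ → H →L[ℂ] K} (hF : DifferentiableOn ℂ F (Metric.ball 0 1)) {C : ℝ}
    (hC : ∀ z ∈ Metric.ball (0 : ℂ) 1, ‖F z‖ ≤ C) (f : Hardy H) :
    ∃ h : Hardy K, (∀ z : 𝔻, h z = F z (f z)) ∧ ‖h‖ ≤ C * ‖f‖ := by
  have hC0 : 0 ≤ C := (norm_nonneg _).trans (hC 0 (by simp))
  set g : ℂ → H := fun z => ∑' n, z ^ n • coeff f n with hg
  have hfg : ∀ z : 𝔻, f z = g z := fun z => (hasSum_coeff f z).tsum_eq.symm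
  have hgd : DifferentiableOn ℂ g (Metric.ball 0 1) := differentiableOn_extension f
  have hhd : DifferentiableOn ℂ (fun z => F z (g z)) (Metric.ball 0 1) := hF.clm_apply hgd
  set c : ℕ → K := fun n => ((n.factorial : ℂ)⁻¹ • iteratedDeriv n (fun z => F z (g z)) 0) with hc
  have hsum : ∀ z : 𝔻, HasSum (fun n => (z : ℂ) ^ n • c n) (F z (f z)) := fun z => by
    have := Complex.hasSum_taylorSeries_on_ball hhd (mem_ball_zero_iff.2 z.norm_lt_one)
    simp only [sub_zero] at this
    rw [hfg]
    refine this.congr_fun fun n => ?_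
    rw [hc, smul_comm]
  have hpi : (0 : ℝ) ≤ (2 * Real.pi)⁻¹ := by positivity
  have hr : ∀ (r : ℝ), 0 ≤ r → r < 1 → ∀ s : Finset ℕ,
      ∑ n ∈ s, (r ^ n * ‖c n‖) ^ 2 ≤ (C * ‖f‖) ^ 2 := by
    intro r h0 h1 s
    have p1 := parseval_disk c (fun z : 𝔻 => F z (f z)) hsum h0 h1
    have p2 := parseval_disk (fun n => coeff f n) f (hasSum_coeff f) h0 h1
    calc ∑ n ∈ s, (r ^ n * ‖c n‖) ^ 2
        ≤ _ := sum_le_hasSum s (fun n _ => by positivity) p1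
      _ ≤ (2 * Real.pi)⁻¹ * ∫ t in (0 : ℝ)..2 * Real.pi,
            C ^ 2 * ‖f (circlePt r h0 h1 t)‖ ^ 2 := by
          refine mul_le_mul_of_nonneg_left ?_ hpi
          refine intervalIntegral.integral_mono_on (by positivity)
            (Continuous.intervalIntegrable ?_ _ _) (Continuous.intervalIntegrable ?_ _ _) ?_
          · exact (continuous_circle (f := fun z : 𝔻 => F z (f z)) hhd
              (fun z => by simp only [hfg]) h0 h1).norm.pow 2
          · exact ((continuous_circle hgd hfg h0 h1).norm.pow 2).const_mul _
          · intro t _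
            rw [← mul_pow]
            gcongr
            refine (ContinuousLinearMap.le_opNorm _ _).trans ?_
            gcongr
            exact hC _ (mem_ball_zero_iff.2 (circlePt r h0 h1 t).norm_lt_one)
      _ = C ^ 2 * ((2 * Real.pi)⁻¹ * ∫ t in (0 : ℝ)..2 * Real.pi,
            ‖f (circlePt r h0 h1 t)‖ ^ 2) := by
          rw [intervalIntegral.integral_const_mul]; ring
      _ ≤ C ^ 2 * ‖f‖ ^ 2 := by
          gcongr
          refine hasSum_le (fun n => ?_) p2 (hasSum_norm_sq f)
          gcongr
          exact mul_le_of_le_one_left (norm_nonneg _) (pow_le_one₀ h0 h1.le)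
      _ = (C * ‖f‖) ^ 2 := by ring
  have hs : ∀ s : Finset ℕ, ∑ n ∈ s, ‖c n‖ ^ 2 ≤ (C * ‖f‖) ^ 2 := by
    intro s
    have hcont : Continuous fun r : ℝ => ∑ n ∈ s, (r ^ n * ‖c n‖) ^ 2 := by fun_prop
    have ht : Tendsto (fun r : ℝ => ∑ n ∈ s, (r ^ n * ‖c n‖) ^ 2) (𝓝[<] 1)
        (𝓝 (∑ n ∈ s, ‖c n‖ ^ 2)) := by
      have := (hcont.tendsto 1).mono_left (nhdsWithin_le_nhds (s := Set.Iio 1))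
      simpa using this
    refine le_of_tendsto ht ?_
    filter_upwards [Ioo_mem_nhdsLT (show (0 : ℝ) < 1 by norm_num)] with r hr'
    exact hr r hr'.1.le hr'.2 s
  have hmem : Memℓp c 2 := by
    refine memℓp_gen' (C := (C * ‖f‖) ^ 2) fun s => ?_
    simpa using hs s
  refine ⟨⟨fun z => F z (f z), ⟨c, hmem⟩, hsum⟩, fun z => rfl, ?_⟩
  set h : Hardy K := ⟨fun z => F z (f z), ⟨c, hmem⟩, hsum⟩ with hh
  have hcoeff : coeff h = ⟨c, hmem⟩ := coeff_unique (hasSum_coeff h) hsum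
  have hn := hasSum_norm_sq h
  rw [hcoeff] at hn
  exact le_of_sq_le_sq (hasSum_le_of_sum_le hn hs) (by positivity)

/-- The multiplication operator `M_F : H²_H(𝔻) → H²_K(𝔻)`, `(M_F f)(z) = F(z) f(z)`. -/
def mulOp (F : ℂ → H →L[ℂ] K) (hF : IsHInf F) : Hardy H →L[ℂ] Hardy K :=
  LinearMap.mkContinuousOfExistsBound
    { toFun := fun f =>
        ⟨fun z => F z (f z), by
          obtain ⟨C, hC⟩ := hF.bounded
          obtain ⟨h, hh, -⟩ := exists_mul hF.differentiableOn hC f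
          have : (fun z : 𝔻 => F z (f z)) = h.1 := funext fun z => (hh z).symm
          exact this ▸ h.2⟩
      map_add' := fun f g => Hardy.ext fun z => map_add (F z) (f z) (g z)
      map_smul' := fun c f => Hardy.ext fun z => map_smul (F z) c (f z) }
    (by
      obtain ⟨C, hC⟩ := hF.bounded
      refine ⟨C, fun f => ?_⟩
      obtain ⟨h, hh, hn⟩ := exists_mul hF.differentiableOn hC f
      refine le_of_eq_of_le (congrArg norm (Hardy.ext fun z => ?_)) hn
      exact (hh z).symm)

@[simp] theorem mulOp_apply (F : ℂ → H →L[ℂ] K) (hF : IsHInf F) (f : Hardy H) (z : 𝔻) :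
    mulOp F hF f z = F z (f z) := rfl

/-- `H²_M(𝔻)` for a subspace `M` of `K`, as a subset of `H²_K(𝔻)`: the functions with values
in `M`. -/
def hardyOf (M : Submodule ℂ K) : Set (Hardy K) := {f | ∀ z : 𝔻, f z ∈ M}

/-- `F` is outer: `F ∈ H^∞` and the range of `M_F` is a dense subset of `H²_M(𝔻)` for some
closed subspace `M` of `K`. -/
def IsOuter (F : ℂ → H →L[ℂ] K) : Prop :=
  ∃ hF : IsHInf F, ∃ M : Submodule ℂ K, IsClosed (M : Set K) ∧
    closure (Set.range (mulOp F hF)) = hardyOf M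

/-- A bounded operator is a partial isometry if it is isometric on the orthogonal complement of its
kernel. -/
def IsPartialIsometry {X Y : Type*} [NormedAddCommGroup X] [InnerProductSpace ℂ X]
    [NormedAddCommGroup Y] [InnerProductSpace ℂ Y] (T : X →L[ℂ] Y) : Prop :=
  ∀ x ∈ (LinearMap.ker (T : X →ₗ[ℂ] Y))ᗮ, ‖T x‖ = ‖x‖

/-- `V` is inner: `V ∈ H^∞` and `M_V` is a partial isometry. -/
def IsInner (V : ℂ → H →L[ℂ] K) : Prop :=
  ∃ hV : IsHInf V, IsPartialIsometry (mulOp V hV)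

end HardyFactorization

end

noncomputable section

namespace HardyFactorization

variable {H K : Type*} [NormedAddCommGroup H] [InnerProductSpace ℂ H] [CompleteSpace H]
  [NormedAddCommGroup K] [InnerProductSpace ℂ K] [CompleteSpace K]

/-! The proof is the Beurling–Lax–Halmos argument. Write `S` for multiplication by `z` and `T` for
`M_A`. As `T` commutes with `S`, the closure `N` of its range is `S`-invariant. With `E = N ⊖ SN`,
the spaces `Sⁿ E` are mutually orthogonal and span `N`, so `N = U H²_E` for an isometry `U`
commuting with `S` (`exists_isometry_range_eq`). Then `X = U* T` has dense range, commutes with `S`,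
and `T = U X`.

The theorem asks for `H`, not `E`, as the intermediate space. A vector of `E` orthogonal to the
images under `T` of the constants is orthogonal to all of `N`, hence zero; so `E` maps injectively
into `H`, and the polar part of that map is an isometry `J : E → H` (`exists_wandering_isometry`).

Now `T = (U M_{J*}) (M_J X)`. The right factor has range dense in `H²_{J(E)}`, the left one is a
partial isometry, and both commute with `S`. Operators commuting with `S` are multiplications by
bounded holomorphic functions (`isHInf_symbol`, `mulOp_symbol`), which gives `V` and `F`. -/

/-! ### Taylor coefficients, constants and the shift -/

theorem coeff_eq_of_hasSum {f : Hardy H} {c : ℕ → H}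
    (hc : ∀ z : 𝔻, HasSum (fun n => (z : ℂ) ^ n • c n) (f z)) (n : ℕ) : coeff f n = c n := by
  refine sub_eq_zero.1 (coeff_eq_zero (fun n => coeff f n - c n) (fun z => ?_) n)
  simpa [smul_sub] using (hasSum_coeff f z).sub (hc z)

theorem norm_eq_norm_coeff (f : Hardy H) : ‖f‖ = ‖coeff f‖ := rfl

theorem inner_eq_inner_coeff (f g : Hardy H) : inner ℂ f g = inner ℂ (coeff f) (coeff g) := rfl

theorem Hardy.ext_coeff {f g : Hardy H} (h : ∀ n, coeff f n = coeff g n) : f = g :=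
  coeff.injective (lp.ext (funext h))

/-- The `n`-th Taylor coefficient as a bounded operator. -/
def coeffL (n : ℕ) : Hardy H →L[ℂ] H :=
  LinearMap.mkContinuous
    { toFun := fun f => coeff f n
      map_add' := fun f g => by rw [map_add]; rfl
      map_smul' := fun c f => by rw [map_smul]; rfl } 1 fun f => by
    rw [one_mul]
    exact lp.norm_apply_le_norm (by norm_num) (coeff f) n

theorem hasSum_monomial (n : ℕ) (h : H) (z : ℂ) :
    HasSum (fun m => z ^ m • (lp.single 2 n h : lp (fun _ : ℕ => H) 2) m) (z ^ n • h) := by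
  have := hasSum_single (f := fun m => z ^ m • (lp.single 2 n h : lp (fun _ : ℕ => H) 2) m) n
    (fun m hm => by simp [lp.single_apply, Pi.single_eq_of_ne hm])
  simpa using this

theorem hasSum_single_zero (h : H) (z : ℂ) :
    HasSum (fun m => z ^ m • (lp.single 2 0 h : lp (fun _ : ℕ => H) 2) m) h := by
  simpa using hasSum_monomial 0 h z

/-- The constant functions. -/
def const : H →ₗᵢ[ℂ] Hardy H where
  toFun h := ⟨fun _ => h, lp.single 2 0 h, fun z => hasSum_single_zero h z⟩
  map_add' _ _ := rfl
  map_smul' _ _ := rfl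
  norm_map' h := by
    rw [norm_eq_norm_coeff]
    refine Eq.trans (congrArg norm ?_)
      (lp.norm_single (E := fun _ : ℕ => H) (p := 2) (by norm_num) 0 h)
    exact coeff_unique (taylor_spec _) fun z => hasSum_single_zero h z

theorem isHInf_id : IsHInf fun z : ℂ => z • ContinuousLinearMap.id ℂ H where
  differentiableOn := by fun_prop
  bounded := ⟨1, fun z hz => by
    rw [norm_smul]
    exact mul_le_one₀ (mem_ball_zero_iff.1 hz).le (norm_nonneg _)
      ContinuousLinearMap.norm_id_le⟩

theorem hasSum_shift (f : Hardy H) (z : 𝔻) :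
    HasSum (fun n => (z : ℂ) ^ n • (Nat.casesOn n 0 (fun m => coeff f m) : H))
      ((z : ℂ) • f z) := by
  rw [← hasSum_nat_add_iff' 1]
  simpa [pow_succ', mul_smul] using (hasSum_coeff f z).const_smul (z : ℂ)

/-- Multiplication by `z` on the Hardy space. -/
def shift : Hardy H →ₗᵢ[ℂ] Hardy H where
  toLinearMap := (mulOp _ isHInf_id : Hardy H →L[ℂ] Hardy H).toLinearMap
  norm_map' f := by
    have h1 := hasSum_norm_sq (mulOp _ isHInf_id f)
    simp_rw [coeff_eq_of_hasSum (f := mulOp _ isHInf_id f) fun z => hasSum_shift f z] at h1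
    rw [← hasSum_nat_add_iff' 1] at h1
    have h2 : ‖mulOp _ isHInf_id f‖ ^ 2 = ‖f‖ ^ 2 :=
      HasSum.unique (by simpa using h1) (hasSum_norm_sq f)
    exact (sq_eq_sq₀ (norm_nonneg _) (norm_nonneg _)).1 h2

@[simp] theorem coeff_shift_zero (f : Hardy H) : coeff (shift f) 0 = 0 :=
  coeff_eq_of_hasSum (f := shift f) (fun z => hasSum_shift f z) 0

@[simp] theorem coeff_shift_succ (f : Hardy H) (n : ℕ) : coeff (shift f) (n + 1) = coeff f n :=
  coeff_eq_of_hasSum (f := shift f) (fun z => hasSum_shift f z) (n + 1)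

theorem shift_pow_apply (n : ℕ) (f : Hardy H) (z : 𝔻) :
    (shift ^ n : Hardy H →ₗᵢ[ℂ] Hardy H) f z = (z : ℂ) ^ n • f z := by
  induction n with
  | zero => simp
  | succ n ih => rw [pow_succ', pow_succ', mul_smul, ← ih]; rfl

theorem coeff_shift_pow_const (n : ℕ) (h : H) :
    coeff ((shift ^ n : Hardy H →ₗᵢ[ℂ] Hardy H) (const h)) = lp.single 2 n h :=
  coeff_unique (hasSum_coeff _) fun z => by
    rw [shift_pow_apply]
    exact hasSum_monomial n h z

theorem hasSum_shift_pow_const (f : Hardy H) :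
    HasSum (fun n => (shift ^ n : Hardy H →ₗᵢ[ℂ] Hardy H) (const (coeff f n))) f := by
  have h := (lp.hasSum_single (p := 2) (by norm_num) (coeff f)).map
    (coeffIsometry (H := H)).symm coeffIsometry.symm.continuous
  have e : coeffIsometry.symm (coeff f) = f := coeffIsometry.symm_apply_apply f
  rw [e] at h
  refine h.congr_fun fun n => ?_
  rw [Function.comp_apply, ← coeff_shift_pow_const]
  exact (coeffIsometry.symm_apply_apply _).symm

/-- Reduces statements about the range of a shift-commuting operator to constants and shifts. -/
theorem eq_const_add_shift (f : Hardy H) : ∃ g, f = const (coeff f 0) + shift g := by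
  have h := (hasSum_nat_add_iff' 1).2 (hasSum_shift_pow_const f)
  -- The partial sums of the tail are shifts, and the range of an isometry is closed.
  have hmem : f - const (coeff f 0) ∈ (shift : Hardy H →ₗᵢ[ℂ] Hardy H).range := by
    have hcl : IsClosed ((shift : Hardy H →ₗᵢ[ℂ] Hardy H).range : Set (Hardy H)) :=
      (shift : Hardy H →ₗᵢ[ℂ] Hardy H).isometry.isClosedEmbedding.isClosed_range
    have h' : HasSum (fun n => (shift ^ (n + 1) : Hardy H →ₗᵢ[ℂ] Hardy H)
        (const (coeff f (n + 1)))) (f - const (coeff f 0)) := by simpa using h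
    refine hcl.mem_of_tendsto h'.tendsto_sum_nat (Eventually.of_forall fun s => ?_)
    refine Submodule.sum_mem _ fun n _ => ⟨(shift ^ n : Hardy H →ₗᵢ[ℂ] Hardy H)
      (const (coeff f (n + 1))), ?_⟩
    rw [pow_succ']; rfl
  obtain ⟨g, hg⟩ := hmem
  exact ⟨g, by rw [← sub_eq_iff_eq_add']; exact hg.symm⟩

/-! ### The reproducing kernel and point evaluations -/

section Kernel

theorem hasSum_norm_pow_sq (w : 𝔻) :
    HasSum (fun n => (‖(w : ℂ)‖ ^ 2) ^ n) (1 - ‖(w : ℂ)‖ ^ 2)⁻¹ :=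
  hasSum_geometric_of_lt_one (by positivity)
    (pow_lt_one₀ (norm_nonneg _) w.norm_lt_one two_ne_zero)

theorem memℓp_kernel (w : 𝔻) (h : H) :
    Memℓp (fun n : ℕ => (starRingEnd ℂ) (w : ℂ) ^ n • h) 2 := by
  refine memℓp_gen ?_
  have := ((hasSum_norm_pow_sq w).summable.mul_right (‖h‖ ^ 2))
  refine this.congr fun n => ?_
  simp [norm_smul, mul_pow, ← pow_mul, mul_comm]

/-- The function `z ↦ (1 - w̄ z)⁻¹ h`. -/
def kernel (w : 𝔻) (h : H) : Hardy H := ofLp ⟨_, memℓp_kernel w h⟩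

theorem coeff_kernel (w : 𝔻) (h : H) (n : ℕ) :
    coeff (kernel w h) n = (starRingEnd ℂ) (w : ℂ) ^ n • h := by
  have : coeff (kernel w h) = ⟨_, memℓp_kernel w h⟩ := coeff.apply_symm_apply _
  rw [this]

theorem norm_kernel_sq (w : 𝔻) (h : H) :
    ‖kernel w h‖ ^ 2 = (1 - ‖(w : ℂ)‖ ^ 2)⁻¹ * ‖h‖ ^ 2 := by
  refine (hasSum_norm_sq (kernel w h)).unique (((hasSum_norm_pow_sq w).mul_right _).congr_fun
    fun n => ?_)
  rw [coeff_kernel]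
  simp [norm_smul, mul_pow, ← pow_mul, mul_comm]

theorem kernel_apply_self (w : 𝔻) (h : H) :
    kernel w h w = (((1 - ‖(w : ℂ)‖ ^ 2)⁻¹ : ℝ) : ℂ) • h := by
  have h1 := (Complex.hasSum_ofReal.2 (hasSum_norm_pow_sq w)).smul_const h
  refine (hasSum_coeff (kernel w h) w).unique (h1.congr_fun fun n => ?_)
  rw [coeff_kernel, smul_smul, ← mul_pow, Complex.mul_conj, Complex.normSq_eq_norm_sq]
  simp

theorem inner_kernel (w : 𝔻) (h : H) (f : Hardy H) :
    inner ℂ (kernel w h) f = inner ℂ h (f w) := by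
  rw [inner_eq_inner_coeff]
  refine (lp.hasSum_inner _ _).unique ?_
  refine ((hasSum_coeff f w).mapL (innerSL ℂ h)).congr_fun fun n => ?_
  rw [coeff_kernel, inner_smul_left]
  simp

/-- Cauchy–Schwarz against the kernel in the direction `f w`; a factor `‖f w‖ ^ 2` is cancelled at
the end, so `f w = 0` is treated apart. -/
theorem norm_apply_sq_le (f : Hardy H) (w : 𝔻) :
    ‖f w‖ ^ 2 ≤ (1 - ‖(w : ℂ)‖ ^ 2)⁻¹ * ‖f‖ ^ 2 := by
  rcases eq_or_ne (f w) 0 with h0 | h0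
  · rw [h0, norm_zero, zero_pow two_ne_zero]
    exact mul_nonneg ((hasSum_norm_pow_sq w).nonneg fun n => by positivity) (by positivity)
  have h1 : ‖f w‖ ^ 2 ≤ ‖kernel w (f w)‖ * ‖f‖ := by
    have := norm_inner_le_norm (𝕜 := ℂ) (kernel w (f w)) f
    rw [inner_kernel, inner_self_eq_norm_sq_to_K] at this
    simpa using this
  have h2 : (‖f w‖ ^ 2) ^ 2 ≤ ((1 - ‖(w : ℂ)‖ ^ 2)⁻¹ * ‖f‖ ^ 2) * ‖f w‖ ^ 2 :=
    calc (‖f w‖ ^ 2) ^ 2 ≤ (‖kernel w (f w)‖ * ‖f‖) ^ 2 := by gcongr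
      _ = _ := by rw [mul_pow, norm_kernel_sq]; ring
  rw [sq] at h2
  exact le_of_mul_le_mul_right h2 (by positivity)

/-- Evaluation at a point of the disk as a bounded operator. -/
def evalL (w : 𝔻) : Hardy H →L[ℂ] H :=
  LinearMap.mkContinuous
    { toFun := fun f => f w
      map_add' := fun _ _ => rfl
      map_smul' := fun _ _ => rfl } (√(1 - ‖(w : ℂ)‖ ^ 2)⁻¹) fun f => by
    have h := Real.sqrt_le_sqrt (norm_apply_sq_le f w)
    rwa [Real.sqrt_mul' _ (by positivity), Real.sqrt_sq (norm_nonneg _),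
      Real.sqrt_sq (norm_nonneg _)] at h

@[simp] theorem evalL_apply (w : 𝔻) (f : Hardy H) : evalL w f = f w := rfl

end Kernel

/-! ### Operators commuting with the shift are multiplications -/

section Symbol

/-- The Taylor coefficients of the symbol of `T`. -/
def symbolCoeff (T : Hardy H →L[ℂ] Hardy K) (n : ℕ) : H →L[ℂ] K :=
  (coeffL n).comp (T.comp const.toContinuousLinearMap)

theorem norm_symbolCoeff_le (T : Hardy H →L[ℂ] Hardy K) (n : ℕ) : ‖symbolCoeff T n‖ ≤ ‖T‖ := by
  refine ContinuousLinearMap.opNorm_le_bound _ T.opNorm_nonneg fun h => ?_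
  refine (lp.norm_apply_le_norm (by norm_num) (coeff (T (const h))) n).trans ?_
  refine (T.le_opNorm _).trans_eq ?_
  rw [const.norm_map]

/-- The operator-valued function `z ↦ (h ↦ (T h)(z))`. -/
def symbol (T : Hardy H →L[ℂ] Hardy K) (z : ℂ) : H →L[ℂ] K :=
  ∑' n, z ^ n • symbolCoeff T n

theorem symbol_apply (T : Hardy H →L[ℂ] Hardy K) (z : 𝔻) (h : H) :
    symbol T z h = T (const h) z := by
  have hs : Summable fun n => (z : ℂ) ^ n • symbolCoeff T n := by
    refine Summable.of_norm_bounded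
      ((summable_geometric_of_lt_one (norm_nonneg (z : ℂ)) z.norm_lt_one).mul_right ‖T‖)
      fun n => ?_
    rw [norm_smul, norm_pow]
    gcongr
    exact norm_symbolCoeff_le T n
  have h1 := hs.hasSum.mapL (ContinuousLinearMap.apply ℂ K h)
  exact h1.unique (hasSum_coeff (T (const h)) z)

theorem differentiableOn_symbol (T : Hardy H →L[ℂ] Hardy K) :
    DifferentiableOn ℂ (symbol T) (Metric.ball 0 1) := by
  intro w hw
  obtain ⟨r, hwr, hr1⟩ := exists_between (mem_ball_zero_iff.1 hw)
  have hr0 : 0 ≤ r := (norm_nonneg w).trans hwr.le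
  have hd : DifferentiableOn ℂ (symbol T) (Metric.ball 0 r) := by
    refine Complex.differentiableOn_tsum_of_summable_norm
      ((summable_geometric_of_lt_one hr0 hr1).mul_right ‖T‖)
      (fun n => by fun_prop) Metric.isOpen_ball fun n z hz => ?_
    rw [norm_smul, norm_pow]
    have hz' : ‖z‖ ≤ r := (mem_ball_zero_iff.1 hz).le
    gcongr
    exact norm_symbolCoeff_le T n
  exact (hd.differentiableAt
    (Metric.isOpen_ball.mem_nhds (mem_ball_zero_iff.2 hwr))).differentiableWithinAt

variable {T : Hardy H →L[ℂ] Hardy K}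

theorem map_shift_pow (hT : ∀ f, T (shift f) = shift (T f)) (n : ℕ) (f : Hardy H) :
    T ((shift ^ n : Hardy H →ₗᵢ[ℂ] Hardy H) f) =
      (shift ^ n : Hardy K →ₗᵢ[ℂ] Hardy K) (T f) := by
  induction n with
  | zero => rfl
  | succ n ih =>
    rw [pow_succ', pow_succ']
    exact (hT _).trans (congrArg shift ih)

/-- By continuity it is enough to compare the two sides on each monomial of the expansion of `f`;
there, commutation with the shift reduces to constants. -/
theorem apply_eq_symbol (hT : ∀ f, T (shift f) = shift (T f)) (f : Hardy H) (z : 𝔻) :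
    T f z = symbol T z (f z) := by
  have h1 := (hasSum_shift_pow_const f).mapL ((evalL z).comp T)
  refine h1.unique (((hasSum_coeff f z).mapL (symbol T z)).congr_fun fun n => ?_)
  rw [map_smul, symbol_apply, ContinuousLinearMap.comp_apply, map_shift_pow hT, evalL_apply,
    shift_pow_apply]

/-- Summing the coefficient bounds would only give `‖T‖ / (1 - ‖z‖)`. Testing `T` on the kernel at
`z` is sharp: evaluation and the norm of the kernel each cost a factor `√c`, and these cancel the
`c` in `kernel_apply_self`. -/
theorem norm_symbol_le (hT : ∀ f, T (shift f) = shift (T f)) (z : 𝔻) : ‖symbol T z‖ ≤ ‖T‖ := by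
  refine ContinuousLinearMap.opNorm_le_bound _ T.opNorm_nonneg fun h => ?_
  set c : ℝ := (1 - ‖(z : ℂ)‖ ^ 2)⁻¹ with hc
  have hc0 : 0 < c :=
    inv_pos.2 (sub_pos.2 (pow_lt_one₀ (norm_nonneg _) z.norm_lt_one two_ne_zero))
  have h1 : c * ‖symbol T z h‖ = ‖T (kernel z h) z‖ := by
    rw [apply_eq_symbol hT, kernel_apply_self, map_smul, norm_smul, Complex.norm_real,
      Real.norm_of_nonneg hc0.le]
  have h2 : (c * ‖symbol T z h‖) ^ 2 ≤ (c * (‖T‖ * ‖h‖)) ^ 2 :=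
    calc (c * ‖symbol T z h‖) ^ 2 ≤ c * ‖T (kernel z h)‖ ^ 2 := by
          rw [h1]; exact norm_apply_sq_le _ _
      _ ≤ c * (‖T‖ * ‖kernel z h‖) ^ 2 := by gcongr; exact T.le_opNorm _
      _ = (c * (‖T‖ * ‖h‖)) ^ 2 := by rw [mul_pow, norm_kernel_sq, ← hc]; ring
  exact le_of_mul_le_mul_left (le_of_sq_le_sq h2 (by positivity)) hc0

theorem isHInf_symbol (hT : ∀ f, T (shift f) = shift (T f)) : IsHInf (symbol T) where
  differentiableOn := differentiableOn_symbol T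
  bounded := ⟨‖T‖, fun z hz =>
    norm_symbol_le hT (Complex.UnitDisc.mk z (mem_ball_zero_iff.1 hz))⟩

theorem mulOp_symbol (hT : ∀ f, T (shift f) = shift (T f)) :
    mulOp (symbol T) (isHInf_symbol hT) = T :=
  ContinuousLinearMap.ext fun f => Hardy.ext fun z => (apply_eq_symbol hT f z).symm

end Symbol

/-! ### Polar decomposition of an injective operator -/

section Polar

variable {X Y : Type*} [NormedAddCommGroup X] [InnerProductSpace ℂ X] [CompleteSpace X]
  [NormedAddCommGroup Y] [InnerProductSpace ℂ Y] [CompleteSpace Y]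

/-- An injective bounded operator between Hilbert spaces has an isometric polar part. -/
theorem exists_linearIsometry_of_injective (B : X →L[ℂ] Y) (hB : Function.Injective B) :
    Nonempty (X →ₗᵢ[ℂ] Y) := by
  -- `P = |B|`; the isometry is the continuous extension of `P x ↦ B x`.
  set P : X →L[ℂ] X := CFC.sqrt (B.adjoint ∘L B)
  have hpos : (0 : X →L[ℂ] X) ≤ B.adjoint ∘L B :=
    (ContinuousLinearMap.nonneg_iff_isPositive _).2
      (ContinuousLinearMap.isPositive_adjoint_comp_self B)
  have hPP : P * P = B.adjoint ∘L B := CFC.sqrt_mul_sqrt_self _ hpos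
  have hPsa : P.adjoint = P := (CFC.sqrt_nonneg (B.adjoint ∘L B)).isSelfAdjoint
  have hnorm : ∀ x, ‖B x‖ = ‖P x‖ := fun x => by
    have h1 : inner ℂ (P x) (P x) = inner ℂ (B x) (B x) := by
      rw [← ContinuousLinearMap.adjoint_inner_right, ← ContinuousLinearMap.adjoint_inner_right,
        hPsa]
      exact congrArg (fun T : X →L[ℂ] X => inner ℂ x (T x)) hPP
    rw [inner_self_eq_norm_sq_to_K, inner_self_eq_norm_sq_to_K] at h1
    have h2 : ‖P x‖ ^ 2 = ‖B x‖ ^ 2 := by exact_mod_cast h1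
    exact ((sq_eq_sq₀ (norm_nonneg _) (norm_nonneg _)).1 h2).symm
  -- `P` is self-adjoint, so the orthogonal complement of its range is its kernel, which is that of
  -- `B`.
  have hdense : DenseRange P := by
    have hker : LinearMap.ker P.toLinearMap = ⊥ := by
      refine (Submodule.eq_bot_iff _).2 fun x hx => hB ?_
      rw [map_zero, ← norm_eq_zero, hnorm, norm_eq_zero]
      exact hx
    have h := ContinuousLinearMap.orthogonal_range P
    rw [hPsa, hker] at h
    have := (Submodule.topologicalClosure_eq_top_iff (K := P.range)).2 h
    exact (Submodule.dense_iff_topologicalClosure_eq_top.2 this)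
  have hle : ∃ C, ∀ x, ‖B.toLinearMap x‖ ≤ C * ‖P.toLinearMap x‖ :=
    ⟨1, fun x => by rw [one_mul]; exact (hnorm x).le⟩
  let J : X →L[ℂ] Y := B.toLinearMap.extendOfNorm P.toLinearMap
  have hJ : ∀ x, J (P x) = B x := LinearMap.extendOfNorm_eq hdense hle
  refine ⟨⟨J.toLinearMap, fun x => ?_⟩⟩
  refine hdense.induction_on (p := fun x => ‖J x‖ = ‖x‖) x
    (isClosed_eq J.continuous.norm continuous_norm) fun y => ?_
  rw [hJ, hnorm]

end Polar

/-! ### Wandering subspaces and shift-invariant subspaces -/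

section Wandering

/-- The wandering subspace `N ⊖ z N`. -/
def wandering (N : Submodule ℂ (Hardy K)) : Submodule ℂ (Hardy K) :=
  N ⊓ (N.map (shift : Hardy K →ₗᵢ[ℂ] Hardy K).toLinearMap)ᗮ

variable {N : Submodule ℂ (Hardy K)}

theorem isClosed_wandering (hN : IsClosed (N : Set (Hardy K))) :
    IsClosed (wandering N : Set (Hardy K)) :=
  hN.inter (Submodule.isClosed_orthogonal _)

theorem shift_pow_mem (hS : ∀ f ∈ N, shift f ∈ N) {f : Hardy K} (hf : f ∈ N) (n : ℕ) :
    (shift ^ n : Hardy K →ₗᵢ[ℂ] Hardy K) f ∈ N := by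
  induction n with
  | zero => exact hf
  | succ n ih => rw [pow_succ']; exact hS _ ih

/-- Cancelling `shift ^ i` leaves `v` against an element of `shift N`; the exponent `k + 1`
guarantees at least one remaining shift. -/
theorem inner_shift_pow_wandering (hS : ∀ f ∈ N, shift f ∈ N) {v w : Hardy K}
    (hv : v ∈ wandering N) (hw : w ∈ wandering N) (i k : ℕ) :
    inner ℂ ((shift ^ i : Hardy K →ₗᵢ[ℂ] Hardy K) v)
      ((shift ^ (i + (k + 1)) : Hardy K →ₗᵢ[ℂ] Hardy K) w) = 0 := by
  rw [pow_add]
  refine ((shift ^ i : Hardy K →ₗᵢ[ℂ] Hardy K).inner_map_map v _).trans ?_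
  refine Submodule.inner_left_of_mem_orthogonal ?_ hv.2
  rw [pow_succ']
  exact ⟨_, shift_pow_mem hS hw.1 k, rfl⟩

theorem orthogonalFamily_wandering (hS : ∀ f ∈ N, shift f ∈ N) :
    OrthogonalFamily ℂ (fun _ : ℕ => wandering N)
      (fun n => (shift ^ n : Hardy K →ₗᵢ[ℂ] Hardy K).comp (wandering N).subtypeₗᵢ) := by
  intro i j hij v w
  rcases Nat.lt_or_gt_of_ne hij with h | h
  · obtain ⟨k, rfl⟩ := Nat.exists_eq_add_of_lt h
    exact inner_shift_pow_wandering hS v.2 w.2 i k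
  · obtain ⟨k, rfl⟩ := Nat.exists_eq_add_of_lt h
    exact inner_eq_zero_symm.1 (inner_shift_pow_wandering hS w.2 v.2 j k)

theorem isClosed_map_shift (hN : IsClosed (N : Set (Hardy K))) :
    IsClosed (N.map (shift : Hardy K →ₗᵢ[ℂ] Hardy K).toLinearMap : Set (Hardy K)) :=
  (shift : Hardy K →ₗᵢ[ℂ] Hardy K).isometry.isClosedEmbedding.isClosedMap _ hN

/-- Split `f` along the closed subspace `shift N`. The other component stays in `N`, hence is
wandering, hence is orthogonal to itself. -/
theorem exists_shift_eq (hN : IsClosed (N : Set (Hardy K))) (hS : ∀ f ∈ N, shift f ∈ N)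
    {f : Hardy K} (hf : f ∈ N) (h : ∀ e ∈ wandering N, inner ℂ e f = 0) :
    ∃ g ∈ N, shift g = f := by
  set N' := N.map (shift : Hardy K →ₗᵢ[ℂ] Hardy K).toLinearMap
  have : CompleteSpace N' := (isClosed_map_shift hN).completeSpace_coe
  obtain ⟨p, hp, q, hq, rfl⟩ := N'.exists_add_mem_mem_orthogonal f
  have hpN : p ∈ N := by
    obtain ⟨g, hg, rfl⟩ := hp
    exact hS g hg
  have hqN : q ∈ N := by simpa using N.sub_mem hf hpN
  have h0 := h q ⟨hqN, hq⟩
  rw [inner_add_right, Submodule.inner_left_of_mem_orthogonal hp hq, zero_add,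
    inner_self_eq_zero] at h0
  obtain ⟨g, hg, hgp⟩ := hp
  exact ⟨g, hg, by rw [h0, add_zero]; exact hgp⟩

/-- Such an `f` is divisible by `z` inside `N`, and the quotient satisfies the same hypotheses;
after `m + 1` divisions the `m`-th coefficient is seen to vanish. The induction therefore runs over
all `f` at once. -/
theorem coeff_eq_zero_of_inner_wandering (hN : IsClosed (N : Set (Hardy K)))
    (hS : ∀ f ∈ N, shift f ∈ N) (m : ℕ) : ∀ f ∈ N,
    (∀ n, ∀ e ∈ wandering N, inner ℂ ((shift ^ n : Hardy K →ₗᵢ[ℂ] Hardy K) e) f = 0) →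
    coeff f m = 0 := by
  induction m with
  | zero =>
    intro f hf h
    obtain ⟨g, -, rfl⟩ := exists_shift_eq hN hS hf (h 0)
    exact coeff_shift_zero g
  | succ m ih =>
    intro f hf h
    obtain ⟨g, hg, rfl⟩ := exists_shift_eq hN hS hf (h 0)
    rw [coeff_shift_succ]
    refine ih g hg fun n e he => ?_
    have := h (n + 1) e he
    rw [pow_succ'] at this
    exact (shift.inner_map_map _ _).symm.trans this

/-- A closed shift-invariant subspace `N` is the image of a Hardy space under an isometry that
commutes with the shift. -/
theorem exists_isometry_range_eq (hN : IsClosed (N : Set (Hardy K)))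
    (hS : ∀ f ∈ N, shift f ∈ N) [CompleteSpace (wandering N)] :
    ∃ U : Hardy (wandering N) →ₗᵢ[ℂ] Hardy K, (∀ f, U (shift f) = shift (U f)) ∧
      Set.range U = N := by
  have hV := orthogonalFamily_wandering hS
  have hsum : ∀ f : Hardy (wandering N), HasSum
      (fun n => (shift ^ n : Hardy K →ₗᵢ[ℂ] Hardy K) (coeff f n : Hardy K))
      (hV.linearIsometry (coeff f)) := fun f => hV.hasSum_linearIsometry (coeff f)
  refine ⟨hV.linearIsometry.comp coeffIsometry.toLinearIsometry, fun f => ?_, ?_⟩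
  -- The constant coefficient of `shift f` is zero, so dropping the first term does not change the
  -- sum.
  · have h1 := (hasSum_nat_add_iff' 1).2 (hsum (shift f))
    have h2 := (hsum f).mapL (shift : Hardy K →ₗᵢ[ℂ] Hardy K).toContinuousLinearMap
    have h3 : HasSum (fun n => (shift ^ (n + 1) : Hardy K →ₗᵢ[ℂ] Hardy K)
        (coeff f n : Hardy K)) (hV.linearIsometry (coeff (shift f))) := by simpa using h1
    refine h3.unique (h2.congr_fun fun n => ?_)
    rw [pow_succ']; rfl
  · have hrange : Set.range (hV.linearIsometry.comp
        (coeffIsometry (H := wandering N)).toLinearIsometry) =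
        (hV.linearIsometry.range : Set (Hardy K)) := by
      exact (coeffIsometry (H := wandering N)).surjective.range_comp hV.linearIsometry
    rw [hrange]
    congr 1
    have hLN : hV.linearIsometry.range ≤ N := by
      rw [hV.range_linearIsometry]
      refine Submodule.topologicalClosure_minimal _ (iSup_le fun n => ?_) hN
      rintro _ ⟨e, rfl⟩
      exact shift_pow_mem hS e.2.1 n
    refine le_antisymm hLN fun f hf => ?_
    have hcl : IsClosed (hV.linearIsometry.range : Set (Hardy K)) := by
      rw [hV.range_linearIsometry]
      exact Submodule.isClosed_topologicalClosure _
    have : CompleteSpace hV.linearIsometry.range := hcl.completeSpace_coe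
    obtain ⟨p, hp, q, hq, rfl⟩ := hV.linearIsometry.range.exists_add_mem_mem_orthogonal f
    have hqN : q ∈ N := by simpa using N.sub_mem hf (hLN hp)
    -- The component of `f` orthogonal to every `shift ^ n` of the wandering subspace has no nonzero
    -- Taylor coefficient.
    have hq0 : q = 0 := Hardy.ext_coeff fun m => by
      rw [coeff_eq_zero_of_inner_wandering hN hS m q hqN fun n e he => ?_, map_zero]
      · rfl
      · refine Submodule.inner_right_of_mem_orthogonal ?_ hq
        exact ⟨lp.single 2 n ⟨e, he⟩, hV.linearIsometry_apply_single _⟩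
    rw [hq0, add_zero]
    exact hp

end Wandering

/-! ### Multiplication by a constant operator -/

section ConstantSymbol

theorem isHInf_const (J : H →L[ℂ] K) : IsHInf fun _ : ℂ => J where
  differentiableOn := differentiableOn_const J
  bounded := ⟨‖J‖, fun _ _ => le_rfl⟩

theorem coeff_mulOp_const (J : H →L[ℂ] K) (f : Hardy H) (n : ℕ) :
    coeff (mulOp _ (isHInf_const J) f) n = J (coeff f n) :=
  coeff_eq_of_hasSum (f := mulOp _ (isHInf_const J) f) (c := fun n => J (coeff f n)) (fun z =>
    ((hasSum_coeff f z).mapL J).congr_fun fun _ => (map_smul J _ _).symm) n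

/-- The adjoint of `M_J` is `M_{J*}`, since both act coefficientwise. -/
theorem inner_mulOp_const_left (J : H →L[ℂ] K) (f : Hardy H) (g : Hardy K) :
    inner ℂ (mulOp _ (isHInf_const J) f) g = inner ℂ f (mulOp _ (isHInf_const J.adjoint) g) := by
  rw [inner_eq_inner_coeff, inner_eq_inner_coeff, lp.inner_eq_tsum, lp.inner_eq_tsum]
  refine tsum_congr fun n => ?_
  rw [coeff_mulOp_const, coeff_mulOp_const, ContinuousLinearMap.adjoint_inner_right]

theorem norm_mulOp_const {J : H →L[ℂ] K} (hJ : ∀ x, ‖J x‖ = ‖x‖) (f : Hardy H) :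
    ‖mulOp _ (isHInf_const J) f‖ = ‖f‖ := by
  have h1 := hasSum_norm_sq (mulOp _ (isHInf_const J) f)
  simp_rw [coeff_mulOp_const, hJ] at h1
  exact (sq_eq_sq₀ (norm_nonneg _) (norm_nonneg _)).1 (h1.unique (hasSum_norm_sq f))

end ConstantSymbol

theorem mulOp_shift {A : ℂ → H →L[ℂ] K} (hA : IsHInf A) (f : Hardy H) :
    mulOp A hA (shift f) = shift (mulOp A hA f) :=
  Hardy.ext fun z => map_smul (A z) (z : ℂ) (f z)

theorem isPartialIsometry_comp_mulOp_adjoint {E : Type*} [NormedAddCommGroup E]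
    [InnerProductSpace ℂ E] [CompleteSpace E] (J : E →ₗᵢ[ℂ] H) (U : Hardy E →ₗᵢ[ℂ] Hardy K) :
    IsPartialIsometry (U.toContinuousLinearMap.comp
      (mulOp _ (isHInf_const J.toContinuousLinearMap.adjoint))) := by
  intro x hx
  set MJ := mulOp _ (isHInf_const J.toContinuousLinearMap)
  set MJ' := mulOp _ (isHInf_const J.toContinuousLinearMap.adjoint)
  have hJJ : ∀ e : E, J.toContinuousLinearMap.adjoint (J e) = e := fun e =>
    congrArg (fun S : E →L[ℂ] E => S e)
      ((ContinuousLinearMap.norm_map_iff_adjoint_comp_self J.toContinuousLinearMap).1 J.norm_map)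
  have hleft : ∀ f : Hardy E, MJ' (MJ f) = f := fun f => Hardy.ext fun z => hJJ (f z)
  have hker : x - MJ (MJ' x) ∈ LinearMap.ker (U.toContinuousLinearMap.comp MJ').toLinearMap := by
    change U (MJ' (x - MJ (MJ' x))) = 0
    rw [map_sub, hleft, sub_self, map_zero]
  -- `MJ ∘ MJ'` is an orthogonal projection and `x - MJ (MJ' x)` lies in the kernel, so for `x`
  -- orthogonal to the kernel this difference is orthogonal to itself.
  have hx' : x = MJ (MJ' x) := by
    have h1 : inner ℂ (x - MJ (MJ' x)) x = 0 := Submodule.inner_right_of_mem_orthogonal hker hx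
    have h2 : inner ℂ (MJ (MJ' x)) (x - MJ (MJ' x)) = 0 := by
      refine (inner_mulOp_const_left _ _ _).trans ?_
      change inner ℂ (MJ' x) (MJ' (x - MJ (MJ' x))) = 0
      rw [map_sub, hleft, sub_self, inner_zero_right]
    refine sub_eq_zero.1 (inner_self_eq_zero (𝕜 := ℂ).1 ?_)
    rw [inner_sub_right, h1, inner_eq_zero_symm.1 h2, sub_zero]
  calc ‖U (MJ' x)‖ = ‖MJ' x‖ := U.norm_map _
    _ = ‖MJ (MJ' x)‖ := (norm_mulOp_const (J := J.toContinuousLinearMap) J.norm_map _).symm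
    _ = ‖x‖ := by rw [← hx']

theorem range_mulOp_const {E : Type*} [NormedAddCommGroup E]
    [InnerProductSpace ℂ E] [CompleteSpace E] (J : E →ₗᵢ[ℂ] H) :
    Set.range (mulOp _ (isHInf_const J.toContinuousLinearMap)) = hardyOf J.range := by
  refine Set.Subset.antisymm ?_ fun f hf => ?_
  · rintro _ ⟨g, rfl⟩ z
    exact ⟨g z, rfl⟩
  · refine ⟨mulOp _ (isHInf_const J.toContinuousLinearMap.adjoint) f, Hardy.ext fun z => ?_⟩
    obtain ⟨e, he⟩ := hf z
    have hJJ : J.toContinuousLinearMap.adjoint (J e) = e :=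
      congrArg (fun S : E →L[ℂ] E => S e)
        ((ContinuousLinearMap.norm_map_iff_adjoint_comp_self J.toContinuousLinearMap).1 J.norm_map)
    change J (J.toContinuousLinearMap.adjoint (f z)) = f z
    rw [← he]
    exact congrArg J hJJ

/-! ### The closed range and its wandering subspace -/

section Range

variable (T : Hardy H →L[ℂ] Hardy K)

/-- The closure of the range of `T`. -/
def closedRange : Submodule ℂ (Hardy K) := T.range.topologicalClosure

theorem isClosed_closedRange : IsClosed (closedRange T : Set (Hardy K)) :=
  Submodule.isClosed_topologicalClosure _

theorem coe_closedRange : (closedRange T : Set (Hardy K)) = closure (Set.range T) := rfl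

theorem mem_closedRange (f : Hardy H) : T f ∈ closedRange T := subset_closure ⟨f, rfl⟩

variable {T}

theorem shift_mem_closedRange (hT : ∀ f, T (shift f) = shift (T f)) :
    ∀ f ∈ closedRange T, shift f ∈ closedRange T := fun f hf => by
  refine map_mem_closure (t := Set.range T)
    (shift : Hardy K →ₗᵢ[ℂ] Hardy K).continuous hf ?_
  rintro _ ⟨g, rfl⟩
  exact ⟨shift g, hT g⟩

/-- The wandering subspace of the closed range of `T : H²_H → H²_K` embeds isometrically
into `H`. -/
theorem exists_wandering_isometry (hT : ∀ f, T (shift f) = shift (T f))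
    [CompleteSpace (wandering (closedRange T))] :
    Nonempty (wandering (closedRange T) →ₗᵢ[ℂ] H) := by
  set C : H →L[ℂ] Hardy K := T.comp const.toContinuousLinearMap
  refine exists_linearIsometry_of_injective
    (C.adjoint.comp (wandering (closedRange T)).subtypeL) ?_
  refine (injective_iff_map_eq_zero _).2 fun e he => ?_
  have he' : C.adjoint (e : Hardy K) = 0 := he
  -- `T f` is the image of a constant, orthogonal to `e` because `C.adjoint e = 0`, plus a shift of
  -- an element of the closed range, orthogonal to `e` because `e` is wandering.
  have h1 : ∀ f, inner ℂ (T f) (e : Hardy K) = 0 := fun f => by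
    obtain ⟨g, hg⟩ := eq_const_add_shift f
    rw [hg, map_add, inner_add_left, hT]
    have hc : inner ℂ (T (const (coeff f 0))) (e : Hardy K) = 0 := by
      change inner ℂ (C (coeff f 0)) (e : Hardy K) = 0
      rw [← ContinuousLinearMap.adjoint_inner_right, he', inner_zero_right]
    rw [hc, zero_add]
    exact Submodule.inner_right_of_mem_orthogonal
      (Submodule.mem_map_of_mem (mem_closedRange T g)) e.2.2
  have h2 : closedRange T ≤ (ℂ ∙ (e : Hardy K))ᗮ := by
    refine Submodule.topologicalClosure_minimal _ ?_ (Submodule.isClosed_orthogonal _)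
    rintro _ ⟨f, rfl⟩
    exact Submodule.mem_orthogonal_singleton_iff_inner_left.2 (h1 f)
  have h3 := Submodule.mem_orthogonal_singleton_iff_inner_left.1 (h2 e.2.1)
  exact Subtype.ext (inner_self_eq_zero.1 h3)

end Range

end HardyFactorization

end

/-! ### The factorization -/

open HardyFactorization in
theorem mainTheorem4 {H K : Type*}
    [NormedAddCommGroup H] [InnerProductSpace ℂ H] [CompleteSpace H]
    [NormedAddCommGroup K] [InnerProductSpace ℂ K] [CompleteSpace K]
    (A : ℂ → H →L[ℂ] K) (hA : IsHInf A) :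
    ∃ (F : ℂ → H →L[ℂ] H) (V : ℂ → H →L[ℂ] K), IsOuter F ∧ IsInner V ∧
      ∀ z ∈ Metric.ball (0 : ℂ) 1, A z = (V z).comp (F z) := by
  set T := mulOp A hA
  have hT : ∀ f, T (shift f) = shift (T f) := mulOp_shift hA
  have hN := isClosed_closedRange T
  have : CompleteSpace (wandering (closedRange T)) := (isClosed_wandering hN).completeSpace_coe
  obtain ⟨U, hUS, hUr⟩ := exists_isometry_range_eq hN (shift_mem_closedRange hT)
  obtain ⟨J⟩ := exists_wandering_isometry hT
  set MJ := mulOp _ (isHInf_const J.toContinuousLinearMap) with hMJ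
  set MJ' := mulOp _ (isHInf_const J.toContinuousLinearMap.adjoint)
  -- `X` is `T` read through the identification of its closed range with a Hardy space by `U`.
  set X : Hardy H →L[ℂ] Hardy (wandering (closedRange T)) :=
    U.toContinuousLinearMap.adjoint.comp T
  have hUU : ∀ g, U.toContinuousLinearMap.adjoint (U g) = g := fun g =>
    congrArg (fun S : Hardy (wandering (closedRange T)) →L[ℂ] _ => S g)
      ((ContinuousLinearMap.norm_map_iff_adjoint_comp_self U.toContinuousLinearMap).1 U.norm_map)
  have hJJ : ∀ e, J.toContinuousLinearMap.adjoint (J e) = e := fun e =>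
    congrArg (fun S : wandering (closedRange T) →L[ℂ] _ => S e)
      ((ContinuousLinearMap.norm_map_iff_adjoint_comp_self J.toContinuousLinearMap).1 J.norm_map)
  have hUX : ∀ f, U (X f) = T f := fun f => by
    obtain ⟨g, hg⟩ : T f ∈ Set.range U := hUr ▸ mem_closedRange T f
    change U (U.toContinuousLinearMap.adjoint (T f)) = T f
    rw [← hg, hUU]
  have hXS : ∀ f, X (shift f) = shift (X f) := fun f =>
    U.injective (by rw [hUX, hT, hUS, hUX])
  -- Density can be tested after applying the embedding `U`, where `U ∘ X = T` is dense in the range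
  -- of `U`.
  have hXd : DenseRange X := by
    intro g
    have hg : U g ∈ closure (Set.range T) := by
      rw [← coe_closedRange, ← hUr]
      exact ⟨g, rfl⟩
    rw [U.isometry.isEmbedding.isInducing.closure_eq_preimage_closure_image]
    refine closure_mono ?_ hg
    rintro _ ⟨f, rfl⟩
    exact ⟨X f, ⟨f, rfl⟩, hUX f⟩
  have hFS : ∀ f, (MJ.comp X) (shift f) = shift ((MJ.comp X) f) := fun f => by
    change MJ (X (shift f)) = shift (MJ (X f))
    rw [hXS]
    exact mulOp_shift _ _
  have hVS : ∀ f, (U.toContinuousLinearMap.comp MJ') (shift f) =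
      shift ((U.toContinuousLinearMap.comp MJ') f) := fun f => by
    change U (MJ' (shift f)) = shift (U (MJ' f))
    rw [← hUS]
    exact congrArg U (mulOp_shift _ _)
  refine ⟨symbol (MJ.comp X), symbol (U.toContinuousLinearMap.comp MJ'),
    ⟨isHInf_symbol hFS, J.range, ?_, ?_⟩, ⟨isHInf_symbol hVS, ?_⟩, fun z hz => ?_⟩
  · exact J.isometry.isClosedEmbedding.isClosed_range
  · have hMJi : Isometry MJ := AddMonoidHomClass.isometry_of_norm MJ fun f =>
      norm_mulOp_const (J := J.toContinuousLinearMap) J.norm_map f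
    rw [mulOp_symbol hFS, ← range_mulOp_const J, ← hMJ, ContinuousLinearMap.coe_comp, Set.range_comp,
      hMJi.isClosedEmbedding.closure_image_eq, hXd.closure_range, Set.image_univ]
  · rw [mulOp_symbol hVS]
    exact isPartialIsometry_comp_mulOp_adjoint J U
  -- Evaluate on the constant function `h`: since `MJ' ∘ MJ = id`, the product of the two operators
  -- is `U ∘ X = T`.
  · ext h
    set w : Complex.UnitDisc := Complex.UnitDisc.mk z (mem_ball_zero_iff.1 hz)
    have h1 : symbol (MJ.comp X) z h = MJ (X (const h)) w := symbol_apply (MJ.comp X) w h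
    have h2 : U (MJ' (MJ (X (const h)))) w =
        symbol (U.toContinuousLinearMap.comp MJ') z (MJ (X (const h)) w) :=
      apply_eq_symbol hVS (MJ (X (const h))) w
    have h3 : MJ' (MJ (X (const h))) = X (const h) :=
      Hardy.ext fun y => hJJ (X (const h) y)
    rw [h3, hUX] at h2
    rw [ContinuousLinearMap.comp_apply, h1, ← h2]
    rfl
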